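/- For an integer $d\ge 0$, let $GMM_d(\infty)$ be the set of finite Gaussian mixtures on $\mathbb{R}^d$, i.e. probability measures of the form $\sum_{k=1}^K \pi_k\,\mathcal N(m_k,\Sigma_k)$ with $K\ge 1$, $\pi_k\ge 0$, $\sum_k\pi_k=1$, $m_k\in\mathbb R^d$ and $\Sigma_k$ symmetric positive semidefinite (possibly singular); define $GMM_{2d}(\infty)$ likewise on $\mathbb R^{2d}=\mathbb R^d\times\mathbb R^d$. For $\mu_0,\mu_1\in GMM_d(\infty)$ let $\Pi(\mu_0,\mu_1)$ be the set of probability measures on $\mathbb R^d\times\mathbb R^d$ with marginals $\mu_0$ and $\mu_1$, and set $$MW_2(\mu_0,\mu_1)=\Bigl(\inf_{\gamma\in\Pi(\mu_0,\mu_1)\cap GMM_{2d}(\infty)}\int_{\mathbb R^d\times\mathbb R^d}\|x-y\|^2\,d\gamma(x,y)\Bigr)^{1/2},$$ where $\|\cdot\|$ is the Euclidean norm. Then $MW_2$ is a (finite) metric on $GMM_d(\infty)$, and $(GMM_d(\infty),MW_2)$ is a geodesic space: any two points $\mu_0,\mu_1$ are joined by a continuous path $(\rho_t)_{t\in[0,1]}$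 whose length $\sup_{0= t_0\le t_1\le\dots\le t_N= 1}\sum_{i=1}^N MW_2(\rho_{t_{i-1}},\rho_{t_i})$ equals $MW_2(\mu_0,\mu_1)$. More explicitly, for all $\mu_0,\mu_1\in GMM_d(\infty)$ the infimum defining $MW_2(\mu_0,\mu_1)$ is attained, and for every minimizer $\gamma^*$, with $P_t(x,y)=(1-t)x+ty$, the measures $\mu_t=(P_t)_\#\gamma^*$, $t\in[0,1]$, form a continuous path in $(GMM_d(\infty),MW_2)$ from $\mu_0$ to $\mu_1$ that satisfies $MW_2(\mu_s,\mu_t)=|t-s|\,MW_2(\mu_0,\mu_1)$ for all $s,t\in[0,1]$ and has length $MW_2(\mu_0,\mu_1)$. -/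

import Mathlib

open MeasureTheory ProbabilityTheory
open scoped ENNReal NNReal unitInterval

noncomputable section

/-- Gaussian mixtures on `E` with at most `K` components: the measures `∑ k, π k • g k` with
weights `π` in the simplex and `g k` Gaussian. Degenerate Gaussians (singular covariance, such as
Dirac masses) are allowed, as in Mathlib's `IsGaussian`; zero weights are allowed. -/
def GMMOfSize (E : Type*) [TopologicalSpace E] [AddCommMonoid E] [Module ℝ E]
    [MeasurableSpace E] (K : ℕ) : Set (Measure E) :=
  {μ | ∃ (π : Fin K → ℝ≥0) (g : Fin K → Measure E),
    ∑ k, π k = 1 ∧ (∀ k, IsGaussian (g k)) ∧ μ = ∑ k, π k • g k}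

/-- All finite Gaussian mixtures on `E`. -/
def GMM (E : Type*) [TopologicalSpace E] [AddCommMonoid E] [Module ℝ E]
    [MeasurableSpace E] : Set (Measure E) :=
  ⋃ K : ℕ, GMMOfSize E K

section Distance

variable {E : Type*} [NormedAddCommGroup E] [NormedSpace ℝ E] [MeasurableSpace E]

/-- The couplings of `μ` and `ν` (measures on `E × E` with marginals `μ` and `ν`) that are finite
Gaussian mixtures on `E × E`. -/
def gmmPlans (μ ν : Measure E) : Set (Measure (E × E)) :=
  {γ | γ.fst = μ ∧ γ.snd = ν} ∩ GMM (E × E)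

/-- The quadratic transport cost of a plan. -/
def transportCost (γ : Measure (E × E)) : ℝ≥0∞ :=
  ∫⁻ z, ENNReal.ofReal (‖z.1 - z.2‖ ^ 2) ∂γ

/-- The mixture Wasserstein distance, a priori with values in `[0, ∞]`. -/
def MW₂ (μ ν : Measure E) : ℝ≥0∞ :=
  (⨅ γ ∈ gmmPlans μ ν, transportCost γ) ^ (1 / 2 : ℝ)

/-- `γ` is an optimal plan for `MW₂`: an admissible plan of minimal cost. -/
def IsOptimalPlan (μ ν : Measure E) (γ : Measure (E × E)) : Prop :=
  γ ∈ gmmPlans μ ν ∧ ∀ γ' ∈ gmmPlans μ ν, transportCost γ ≤ transportCost γ'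

/-- The interpolation map `(x, y) ↦ (1 - t) x + t y`. -/
def interp (t : ℝ) (z : E × E) : E := (1 - t) • z.1 + t • z.2

end Distance

section Geodesics

variable {X : Type*} [MetricSpace X]

/-- The length of a path: the supremum over subdivisions of the sums of successive distances. -/
def pathLength {x y : X} (ρ : Path x y) : ℝ≥0∞ := eVariationOn ρ Set.univ

/-- A metric space is geodesic if any two points are joined by a (continuous) path whose length
is their distance. -/
def IsGeodesicSpace (X : Type*) [MetricSpace X] : Prop :=
  ∀ x y : X, ∃ ρ : Path x y, pathLength ρ = edist x y

/-- A constant-speed geodesic parametrised by `[0, 1]`. -/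
def IsConstantSpeedGeodesic {x y : X} (ρ : Path x y) : Prop :=
  ∀ s t : I, dist (ρ s) (ρ t) = |(t : ℝ) - s| * dist x y

end Geodesics

end

/-!
Distinct Gaussian measures are linearly independent: restricted to a generic line, their moment
generating functions are exponentials of distinct quadratic polynomials, which grow at different
rates. Hence a mixture determines its weights, and the weights of a mixture of plans project to the
weights of its marginals. Two plans with a common marginal are therefore glued by a coupling of
their weights together with gluings of pairs of Gaussian plans, which gives the triangle inequality.

For the same reason the minimisation defining `MW₂` splits into a transport problem between the
finitely many weights, whose cost is the minimal cost of a Gaussian plan between two components.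
The former has a compact set of competitors. For the latter, a centred Gaussian plan is the image of
a standard Gaussian vector under a pair of linear maps, and the linear maps producing a given
marginal form a compact set.

Pushing an optimal plan by `interp s` and `interp t` gives a plan of cost `|t - s| ^ 2` times the
optimal one, so the interpolation is Lipschitz with constant the distance of its end points; by the
triangle inequality such a path has constant speed.
-/

section LinearIndependence

open Filter Asymptotics

theorem linearIndependent_of_isLittleO {ι X 𝕜 : Type*} [LinearOrder ι] [NormedField 𝕜]
    {l : Filter X} {f : ι → X → 𝕜} (hlt : ∀ i j, i < j → f i =o[l] f j)
    (hne : ∀ i, ∃ᶠ x in l, f i x ≠ 0) : LinearIndependent 𝕜 f := by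
  rw [linearIndependent_iff']
  classical
  intro s c hc
  by_contra! hcon
  obtain ⟨i, his, hci⟩ := hcon
  obtain ⟨m, hm, hmax⟩ := (s.filter fun i => c i ≠ 0).exists_maximal ⟨i, by simp [his, hci]⟩
  rw [Finset.mem_filter] at hm
  have hsmall : (∑ j ∈ s.erase m, c j • f j) =o[l] f m := by
    refine IsLittleO.sum fun j hj => ?_
    obtain ⟨hjm, hjs⟩ := Finset.mem_erase.1 hj
    by_cases hcj : c j = 0
    · rw [hcj, zero_smul]
      exact isLittleO_zero _ _
    · have hle : j ≤ m := (le_total j m).elim id (hmax (by simp [hjs, hcj]))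
      exact (hlt j m (hle.lt_of_ne hjm)).const_mul_left _
  have hlead : ∑ j ∈ s.erase m, c j • f j = fun x => -c m * f m x := by
    rw [← Finset.add_sum_erase _ _ hm.1, add_comm] at hc
    rw [eq_neg_of_add_eq_zero_left hc]
    funext x
    simp
  rw [hlead, isLittleO_const_mul_left_iff (neg_ne_zero.2 hm.2)] at hsmall
  exact isLittleO_irrefl (hne m) hsmall

theorem linearIndependent_exp_quadratic :
    LinearIndependent ℝ (fun (p : ℝ ×ₗ ℝ) (s : ℝ) =>
      Real.exp ((ofLex p).2 * s + (ofLex p).1 * s ^ 2 / 2)) := by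
  refine linearIndependent_of_isLittleO (l := atTop) (fun p q hpq => ?_)
    (fun p => Frequently.of_forall fun x => (Real.exp_pos _).ne')
  rw [Real.isLittleO_exp_comp_exp_comp]
  rcases Prod.Lex.lt_iff.1 hpq with hvar | ⟨hvar, hmean⟩
  · have h : Tendsto (fun s : ℝ => s * (((ofLex q).1 - (ofLex p).1) / 2 * s
        + ((ofLex q).2 - (ofLex p).2))) atTop atTop :=
      tendsto_id.atTop_mul_atTop₀ (tendsto_atTop_add_const_right _ _
        (tendsto_id.const_mul_atTop (by linarith)))
    exact h.congr fun s => by ring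
  · have h : Tendsto (fun s : ℝ => ((ofLex q).2 - (ofLex p).2) * s) atTop atTop :=
      tendsto_id.const_mul_atTop (by linarith)
    exact h.congr fun s => by rw [hvar]; ring

end LinearIndependence

section PolynomialOnLines

open Polynomial

variable {k V : Type*} [CommRing k] [AddCommGroup V] [Module k V] {f g : V → k}

/-- `f` restricts to a polynomial on every affine line. Unlike the notion of a polynomial function,
this needs no coordinates, so it makes sense on an infinite-dimensional space `V`. -/
def PolynomialOnLines (f : V → k) : Prop :=
  ∀ u v : V, ∃ P : k[X], ∀ x : k, f (u + x • v) = P.eval x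

namespace PolynomialOnLines

theorem of_linearMap (ℓ : V →ₗ[k] k) : PolynomialOnLines ℓ := fun u v =>
  ⟨C (ℓ u) + C (ℓ v) * X, fun x => by simp [mul_comm x]⟩

theorem of_bilinForm (B : LinearMap.BilinForm k V) : PolynomialOnLines fun v => B v v :=
  fun u v => ⟨C (B u u) + C (B u v + B v u) * X + C (B v v) * X ^ 2, fun x => by
    simp only [map_add, map_smul, LinearMap.add_apply, LinearMap.smul_apply, smul_eq_mul, eval_add,
      eval_mul, eval_pow, eval_C, eval_X]
    ring⟩

theorem add (hf : PolynomialOnLines f) (hg : PolynomialOnLines g) :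
    PolynomialOnLines (f + g) := fun u v => by
  obtain ⟨P, hP⟩ := hf u v
  obtain ⟨Q, hQ⟩ := hg u v
  exact ⟨P + Q, fun x => by simp [hP, hQ]⟩

theorem sub (hf : PolynomialOnLines f) (hg : PolynomialOnLines g) :
    PolynomialOnLines (f - g) := fun u v => by
  obtain ⟨P, hP⟩ := hf u v
  obtain ⟨Q, hQ⟩ := hg u v
  exact ⟨P - Q, fun x => by simp [hP, hQ]⟩

theorem mul (hf : PolynomialOnLines f) (hg : PolynomialOnLines g) :
    PolynomialOnLines (f * g) := fun u v => by
  obtain ⟨P, hP⟩ := hf u v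
  obtain ⟨Q, hQ⟩ := hg u v
  exact ⟨P * Q, fun x => by simp [hP, hQ]⟩

variable [IsDomain k] [Infinite k]

theorem mul_ne_zero (hf : PolynomialOnLines f) (hg : PolynomialOnLines g) (hf₀ : f ≠ 0)
    (hg₀ : g ≠ 0) : f * g ≠ 0 := by
  obtain ⟨u, hu⟩ := Function.ne_iff.1 hf₀
  obtain ⟨w, hw⟩ := Function.ne_iff.1 hg₀
  obtain ⟨P, hP⟩ := hf u (w - u)
  obtain ⟨Q, hQ⟩ := hg u (w - u)
  have hP₀ : P ≠ 0 := by
    rintro rfl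
    exact hu (by simpa using hP 0)
  have hQ₀ : Q ≠ 0 := by
    rintro rfl
    exact hw (by simpa using hQ 1)
  intro h
  refine _root_.mul_ne_zero hP₀ hQ₀ (Polynomial.funext fun x => ?_)
  rw [eval_mul, ← hP, ← hQ, eval_zero]
  exact congrFun h _

theorem exists_forall_ne_zero {ι : Type*} {f : ι → V → k} {s : Finset ι}
    (hf : ∀ i ∈ s, PolynomialOnLines (f i)) (hf₀ : ∀ i ∈ s, f i ≠ 0) :
    ∃ v, ∀ i ∈ s, f i v ≠ 0 := by
  have hprod : PolynomialOnLines (∏ i ∈ s, f i) ∧ ∏ i ∈ s, f i ≠ 0 :=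
    Finset.prod_induction f (fun g => PolynomialOnLines g ∧ g ≠ 0)
      (fun g h hg hh => ⟨hg.1.mul hh.1, hg.1.mul_ne_zero hh.1 hg.2 hh.2⟩)
      ⟨fun _ _ => ⟨1, by simp⟩, one_ne_zero⟩ fun i hi => ⟨hf i hi, hf₀ i hi⟩
  obtain ⟨v, hv⟩ := Function.ne_iff.1 hprod.2
  rw [Finset.prod_apply] at hv
  exact ⟨v, Finset.prod_ne_zero_iff.1 hv⟩

end PolynomialOnLines

end PolynomialOnLines

section MeasureCombinations

variable {Ω Ω' ι : Type*} [MeasurableSpace Ω] [MeasurableSpace Ω']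

theorem lintegral_linearCombination (m : ι → Measure Ω) (w : ι →₀ ℝ≥0) (f : Ω → ℝ≥0∞) :
    ∫⁻ x, f x ∂(Finsupp.linearCombination ℝ≥0 m w) =
      w.sum fun i r => (r : ℝ≥0∞) * ∫⁻ x, f x ∂m i := by
  rw [Finsupp.linearCombination_apply, Finsupp.sum, lintegral_finsetSum_measure, Finsupp.sum]
  exact Finset.sum_congr rfl fun i _ => lintegral_smul_measure _ _

theorem integral_linearCombination {m : ι → Measure Ω} {w : ι →₀ ℝ≥0} {f : Ω → ℝ}
    (hf : ∀ i ∈ w.support, Integrable f (m i)) :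
    ∫ x, f x ∂(Finsupp.linearCombination ℝ≥0 m w) =
      w.sum fun i r => (r : ℝ) * ∫ x, f x ∂m i := by
  rw [Finsupp.linearCombination_apply, Finsupp.sum, Finsupp.sum,
    integral_finsetSum_measure fun i hi => (hf i hi).smul_measure_nnreal]
  exact Finset.sum_congr rfl fun i _ => integral_smul_nnreal_measure _ _

theorem map_linearCombination (m : ι → Measure Ω) (w : ι →₀ ℝ≥0) {f : Ω → Ω'}
    (hf : Measurable f) : (Finsupp.linearCombination ℝ≥0 m w).map f =
      Finsupp.linearCombination ℝ≥0 (fun i => (m i).map f) w := by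
  ext s hs
  simp only [Measure.map_apply hf hs, Finsupp.linearCombination_apply, Finsupp.sum,
    Measure.finsetSum_apply, Measure.smul_apply]

theorem map_linearCombination_eq_mapDomain {κ : Type*} {m : ι → Measure Ω} {m' : κ → Measure Ω'}
    {f : Ω → Ω'} (hf : Measurable f) {φ : ι → κ} {w : ι →₀ ℝ≥0}
    (h : ∀ i ∈ w.support, (m i).map f = m' (φ i)) :
    (Finsupp.linearCombination ℝ≥0 m w).map f =
      Finsupp.linearCombination ℝ≥0 m' (w.mapDomain φ) := by
  rw [map_linearCombination m w hf, Finsupp.linearCombination_mapDomain]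
  exact Finsupp.sum_congr fun i hi => congrArg (w i • ·) (h i hi)

end MeasureCombinations

section Identifiability

variable {E : Type*} [NormedAddCommGroup E] [NormedSpace ℝ E] [MeasurableSpace E]

/-- The possibly degenerate Gaussian measures on `E`: the components of mixtures. A mixture is
encoded by its weights `w : GaussianMeasure E →₀ ℝ≥0`. -/
abbrev GaussianMeasure (E : Type*) [NormedAddCommGroup E] [NormedSpace ℝ E] [MeasurableSpace E] :
    Type _ :=
  {g : Measure E // IsGaussian g}

instance GaussianMeasure.isGaussian (g : GaussianMeasure E) : IsGaussian g.1 := g.2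

theorem integral_exp_mul_dual (g : Measure E) [IsGaussian g] (L : StrongDual ℝ E) (s : ℝ) :
    ∫ x, Real.exp (s * L x) ∂g = Real.exp (g[L] * s + Var[L; g] * s ^ 2 / 2) := by
  have h := mgf_gaussianReal (IsGaussian.map_eq_gaussianReal (μ := g) L) s
  rwa [Real.coe_toNNReal _ (variance_nonneg _ _)] at h

variable [BorelSpace E]

theorem integrable_exp_mul_dual (g : Measure E) [IsGaussian g] (L : StrongDual ℝ E) (s : ℝ) :
    Integrable (fun x => Real.exp (s * L x)) g := by
  have h : Integrable (fun x => Real.exp (s * x)) (g.map L) := by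
    rw [IsGaussian.map_eq_gaussianReal]
    exact integrable_exp_mul_gaussianReal s
  exact h.comp_measurable L.continuous.measurable

theorem integral_exp_mul_dual_linearCombination (w : GaussianMeasure E →₀ ℝ≥0)
    (L : StrongDual ℝ E) (s : ℝ) :
    ∫ x, Real.exp (s * L x) ∂(Finsupp.linearCombination ℝ≥0 Subtype.val w) =
      w.sum fun g r => (r : ℝ) * Real.exp (g.1[L] * s + Var[L; g.1] * s ^ 2 / 2) := by
  rw [integral_linearCombination fun g _ => integrable_exp_mul_dual g.1 L s]
  simp only [integral_exp_mul_dual]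

variable [CompleteSpace E] [SecondCountableTopology E]

theorem isGaussian_ext_mean_variance {g h : Measure E} [IsGaussian g] [IsGaussian h]
    (hmean : ∀ L : StrongDual ℝ E, g[L] = h[L])
    (hvar : ∀ L : StrongDual ℝ E, Var[L; g] = Var[L; h]) : g = h := by
  refine Measure.ext_of_charFunDual (funext fun L => ?_)
  rw [IsGaussian.charFunDual_eq, IsGaussian.charFunDual_eq, integral_complex_ofReal,
    integral_complex_ofReal, hmean, hvar]

theorem exists_mean_add_variance_ne {g h : Measure E} [IsGaussian g] [IsGaussian h] (hgh : g ≠ h) :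
    ∃ L : StrongDual ℝ E, g[L] + Var[L; g] ≠ h[L] + Var[L; h] := by
  by_contra! heq
  -- The mean is odd and the variance even in `L`, so comparing `L` with `-L` separates them.
  have hneg : ∀ L : StrongDual ℝ E, -g[L] + Var[L; g] = -h[L] + Var[L; h] := fun L => by
    simpa [integral_neg, variance_neg] using heq (-L)
  exact hgh (isGaussian_ext_mean_variance (fun L => by linarith [heq L, hneg L])
    fun L => by linarith [heq L, hneg L])

theorem polynomialOnLines_mean_add_variance (g : Measure E) [IsGaussian g] :
    PolynomialOnLines fun L : StrongDual ℝ E => g[L] + Var[L; g] := by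
  have hmean : PolynomialOnLines fun L : StrongDual ℝ E => g[L] := by
    simp_rw [IsGaussian.integral_dual]
    exact PolynomialOnLines.of_linearMap (ContinuousLinearMap.apply ℝ ℝ (∫ x, x ∂g)).toLinearMap
  have hvar : PolynomialOnLines fun L : StrongDual ℝ E => Var[L; g] := by
    simp_rw [← covarianceBilinDual_self_eq_variance (μ := g) IsGaussian.memLp_two_id]
    exact PolynomialOnLines.of_bilinForm (covarianceBilinDual g).toBilinForm
  exact hmean.add hvar

theorem exists_dual_injOn_mean_add_variance (s : Finset (GaussianMeasure E)) :
    ∃ L : StrongDual ℝ E, Set.InjOn (fun g : GaussianMeasure E => g.1[L] + Var[L; g.1]) s := by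
  classical
  obtain ⟨L, hL⟩ := PolynomialOnLines.exists_forall_ne_zero (s := s.offDiag)
    (f := fun (p : GaussianMeasure E × GaussianMeasure E) (L : StrongDual ℝ E) =>
      (p.1.1[L] + Var[L; p.1.1]) - (p.2.1[L] + Var[L; p.2.1]))
    (fun p _ => (polynomialOnLines_mean_add_variance p.1.1).sub
      (polynomialOnLines_mean_add_variance p.2.1))
    fun p hp => by
      obtain ⟨L, hL⟩ := exists_mean_add_variance_ne
        (Subtype.coe_injective.ne (Finset.mem_offDiag.1 hp).2.2)
      exact Function.ne_iff.2 ⟨L, sub_ne_zero.2 hL⟩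
  exact ⟨L, fun g hg h hh hgh => by_contra fun hne =>
    hL (g, h) (Finset.mem_offDiag.2 ⟨hg, hh, hne⟩) (sub_eq_zero.2 hgh)⟩

theorem linearIndependent_isGaussian :
    LinearIndependent ℝ≥0 (Subtype.val : GaussianMeasure E → Measure E) := by
  classical
  intro a b hab
  set S := a.support ∪ b.support with hS
  obtain ⟨L, hL⟩ := exists_dual_injOn_mean_add_variance S
  have hexp : LinearIndepOn ℝ (fun (g : GaussianMeasure E) (s : ℝ) =>
      Real.exp (g.1[L] * s + Var[L; g.1] * s ^ 2 / 2)) S :=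
    linearIndependent_exp_quadratic.comp (fun g : S => toLex (Var[L; g.1.1], g.1.1[L]))
      fun g h hgh => Subtype.ext (hL g.2 h.2 (by
        obtain ⟨hvar, hmean⟩ := Prod.ext_iff.1 (toLex_inj.1 hgh)
        exact congrArg₂ (· + ·) hmean hvar))
  have hmgf : ∑ g ∈ S, (a g : ℝ) • (fun s : ℝ =>
        Real.exp (g.1[L] * s + Var[L; g.1] * s ^ 2 / 2)) =
      ∑ g ∈ S, (b g : ℝ) • fun s : ℝ => Real.exp (g.1[L] * s + Var[L; g.1] * s ^ 2 / 2) := by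
    funext s
    have h := congrArg (fun μ => ∫ x, Real.exp (s * L x) ∂μ) hab
    rw [integral_exp_mul_dual_linearCombination, integral_exp_mul_dual_linearCombination,
      Finsupp.sum_of_support_subset _ Finset.subset_union_left _ (by simp),
      Finsupp.sum_of_support_subset _ Finset.subset_union_right _ (by simp)] at h
    simpa only [Finset.sum_apply, Pi.smul_apply, smul_eq_mul] using h
  ext g
  by_cases hg : g ∈ S
  · exact linearIndepOn_finset_iffₛ.1 hexp (fun g => a g) (fun g => b g) hmgf g hg
  · rw [hS, Finset.mem_union, not_or, Finsupp.notMem_support_iff, Finsupp.notMem_support_iff] at hg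
    rw [hg.1, hg.2]

end Identifiability

section Projection

variable {E F : Type*} [NormedAddCommGroup E] [NormedSpace ℝ E] [MeasurableSpace E] [BorelSpace E]
  [NormedAddCommGroup F] [NormedSpace ℝ F] [MeasurableSpace F] [BorelSpace F]

/-- The image of a Gaussian measure under a continuous linear map. -/
noncomputable def GaussianMeasure.map (T : E →L[ℝ] F) (g : GaussianMeasure E) :
    GaussianMeasure F :=
  ⟨g.1.map T, inferInstance⟩

theorem mapDomain_map_eq_of_map_linearCombination [CompleteSpace F] [SecondCountableTopology F]
    {T : E →L[ℝ] F} {w : GaussianMeasure E →₀ ℝ≥0}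
    {w' : GaussianMeasure F →₀ ℝ≥0}
    (h : (Finsupp.linearCombination ℝ≥0 Subtype.val w).map T =
      Finsupp.linearCombination ℝ≥0 Subtype.val w') :
    w.mapDomain (GaussianMeasure.map T) = w' := by
  have hmap : (Finsupp.linearCombination ℝ≥0 Subtype.val w).map T =
      Finsupp.linearCombination ℝ≥0 Subtype.val (w.mapDomain (GaussianMeasure.map T)) :=
    map_linearCombination_eq_mapDomain T.continuous.measurable fun _ _ => rfl
  exact linearIndependent_isGaussian (hmap.symm.trans h)

end Projection

section GaussianLaw

variable {H F G : Type*} [NormedAddCommGroup H] [InnerProductSpace ℝ H] [FiniteDimensional ℝ H]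
  [MeasurableSpace H] [BorelSpace H]
  [NormedAddCommGroup F] [NormedSpace ℝ F] [MeasurableSpace F] [BorelSpace F]
  [NormedAddCommGroup G] [NormedSpace ℝ G] [MeasurableSpace G] [BorelSpace G]

/-- The law of `m + T Z` for a standard Gaussian vector `Z` of `H`. -/
noncomputable def gaussianLaw (m : F) (T : H →L[ℝ] F) : Measure F :=
  (stdGaussian H).map fun x => m + T x

theorem map_gaussianLaw (m : F) (T : H →L[ℝ] F) (S : F →L[ℝ] G) :
    (gaussianLaw m T).map S = gaussianLaw (S m) (S.comp T) := by
  rw [gaussianLaw, Measure.map_map (by fun_prop) (by fun_prop), gaussianLaw]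
  congr 1
  funext x
  simp

theorem integral_dual_gaussianLaw (m : F) (T : H →L[ℝ] F) (L : StrongDual ℝ F) :
    (gaussianLaw m T)[L] = L m := by
  have hint : Integrable (L.comp T) (stdGaussian H) := IsGaussian.integrable_dual _ _
  have hcomp : ∀ x, L (m + T x) = L m + L.comp T x := fun x => by simp
  rw [gaussianLaw, integral_map (by fun_prop) L.continuous.aestronglyMeasurable]
  simp_rw [hcomp]
  rw [integral_add (integrable_const _) hint, integral_strongDual_stdGaussian]
  simp

theorem variance_dual_gaussianLaw (m : F) (T : H →L[ℝ] F) (L : StrongDual ℝ F) :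
    Var[L; gaussianLaw m T] = ‖L.comp T‖ ^ 2 := by
  have hcomp : (L ∘ fun x => m + T x) = fun x => L m + L.comp T x := by
    funext x
    simp
  rw [gaussianLaw, variance_map L.continuous.aemeasurable (by fun_prop), hcomp,
    variance_const_add (by fun_prop), variance_dual_stdGaussian]

instance isGaussian_gaussianLaw [SecondCountableTopology F] (m : F) (T : H →L[ℝ] F) :
    IsGaussian (gaussianLaw m T) := by
  have h : gaussianLaw m T = ((stdGaussian H).map T).map fun y => m + y :=
    (Measure.map_map (by fun_prop) (by fun_prop)).symm
  rw [h]
  infer_instance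

end GaussianLaw

section CovarianceFactors

set_option maxSynthPendingDepth 3

variable {H F G : Type*} [NormedAddCommGroup H] [InnerProductSpace ℝ H]
  [NormedAddCommGroup F] [NormedSpace ℝ F] [MeasurableSpace F]
  [NormedAddCommGroup G] [NormedSpace ℝ G] [MeasurableSpace G] [BorelSpace G]

variable (H) in
/-- The linear maps `T : H → F` such that `T Z` has the covariance of `μ` for a standard Gaussian
vector `Z` of `H`. In coordinates these are the matrices `T` for which `T Tᵀ` is the covariance
matrix of `μ`. -/
def covarianceFactors (μ : Measure F) : Set (H →L[ℝ] F) :=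
  {T | ∀ L : StrongDual ℝ F, ‖L.comp T‖ ^ 2 = Var[L; μ]}

theorem isClosed_covarianceFactors (μ : Measure F) : IsClosed (covarianceFactors H μ) := by
  simp only [covarianceFactors, Set.ofPred_forall]
  exact isClosed_iInter fun L => isClosed_eq (by fun_prop) continuous_const

variable [BorelSpace F]

theorem comp_mem_covarianceFactors {μ : Measure F} {T : H →L[ℝ] F}
    (hT : T ∈ covarianceFactors H μ) (S : F →L[ℝ] G) :
    S.comp T ∈ covarianceFactors H (μ.map S) := fun L => by
  rw [variance_map L.continuous.aemeasurable S.continuous.aemeasurable]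
  exact hT (L.comp S)

theorem norm_sq_le_of_mem_covarianceFactors [CompleteSpace F] {μ : Measure F} [IsFiniteMeasure μ]
    (hμ : MemLp id 2 μ) {T : H →L[ℝ] F} (hT : T ∈ covarianceFactors H μ) :
    ‖T‖ ^ 2 ≤ ‖covarianceBilinDual μ‖ := by
  suffices h : ‖T‖ ≤ √‖covarianceBilinDual μ‖ from
    (Real.le_sqrt (norm_nonneg _) (norm_nonneg _)).1 h
  refine T.opNorm_le_bound (Real.sqrt_nonneg _) fun x => ?_
  obtain ⟨L, hL, hLx⟩ := exists_dual_vector'' ℝ (T x)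
  have hcomp : ‖L.comp T‖ ≤ √‖covarianceBilinDual μ‖ := by
    refine Real.le_sqrt_of_sq_le ?_
    rw [hT L, ← covarianceBilinDual_self_eq_variance hμ]
    exact (le_abs_self _).trans ((covarianceBilinDual μ).le_of_opNorm₂_le_of_le le_rfl hL hL
      |>.trans_eq (by ring))
  calc ‖T x‖ = L.comp T x := hLx.symm
    _ ≤ ‖L.comp T‖ * ‖x‖ := (le_abs_self _).trans ((L.comp T).le_opNorm x)
    _ ≤ √‖covarianceBilinDual μ‖ * ‖x‖ := by gcongr

theorem isCompact_covarianceFactors [FiniteDimensional ℝ H] [FiniteDimensional ℝ F]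
    {μ : Measure F} [IsFiniteMeasure μ] (hμ : MemLp id 2 μ) :
    IsCompact (covarianceFactors H μ) := by
  have : CompleteSpace F := FiniteDimensional.complete ℝ F
  have : ProperSpace (H →L[ℝ] F) := FiniteDimensional.proper ℝ _
  refine Metric.isCompact_of_isClosed_isBounded (isClosed_covarianceFactors μ) ?_
  exact isBounded_iff_forall_norm_le.2 ⟨√‖covarianceBilinDual μ‖, fun T hT =>
    Real.le_sqrt_of_sq_le (norm_sq_le_of_mem_covarianceFactors hμ hT)⟩

open scoped MatrixOrder in
theorem covarianceFactors_euclideanSpace_nonempty {ι : Type*} [Fintype ι]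
    {μ : Measure (EuclideanSpace ℝ ι)} [IsFiniteMeasure μ] (hμ : MemLp id 2 μ) :
    (covarianceFactors (EuclideanSpace ℝ ι) μ).Nonempty := by
  classical
  let b := (EuclideanSpace.basisFun ι ℝ).toBasis
  let S := LinearMap.toMatrix₂ b b (covarianceBilin μ).toBilinForm
  have hS : S.PosSemidef :=
    (LinearMap.isPosSemidef_iff_posSemidef_toMatrix b).1
      ⟨⟨covarianceBilin_comm⟩, ⟨covarianceBilin_self_nonneg⟩⟩
  have hlaw : gaussianLaw 0 (Matrix.toEuclideanCLM (𝕜 := ℝ) (CFC.sqrt S)) =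
      multivariateGaussian 0 S := rfl
  refine ⟨Matrix.toEuclideanCLM (𝕜 := ℝ) (CFC.sqrt S), fun L => ?_⟩
  obtain ⟨x, rfl⟩ := (InnerProductSpace.toDual ℝ (EuclideanSpace ℝ ι)).surjective L
  have hcov : covarianceBilin (multivariateGaussian 0 S) x x = covarianceBilin μ x x := by
    rw [covarianceBilin_multivariateGaussian hS]
    exact (apply_eq_dotProduct_toMatrix₂_mulVec b b (covarianceBilin μ).toBilinForm x x).symm
  rw [covarianceBilin_self IsGaussian.memLp_two_id, covarianceBilin_self hμ, ← hlaw] at hcov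
  exact (variance_dual_gaussianLaw 0 _ _).symm.trans hcov

theorem covarianceFactors_nonempty [FiniteDimensional ℝ F] {μ : Measure F} [IsFiniteMeasure μ]
    (hμ : MemLp id 2 μ) :
    (covarianceFactors (EuclideanSpace ℝ (Fin (Module.finrank ℝ F))) μ).Nonempty := by
  let φ : F ≃L[ℝ] EuclideanSpace ℝ (Fin (Module.finrank ℝ F)) := toEuclidean
  have hφ : MemLp id 2 (μ.map φ) :=
    (memLp_map_measure_iff aestronglyMeasurable_id φ.continuous.aemeasurable).2
      (φ.toContinuousLinearMap.comp_memLp' hμ)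
  obtain ⟨T, hT⟩ := covarianceFactors_euclideanSpace_nonempty hφ
  have h := comp_mem_covarianceFactors hT φ.symm.toContinuousLinearMap
  rw [Measure.map_map (by fun_prop) (by fun_prop)] at h
  exact ⟨_, by simpa using h⟩

variable [FiniteDimensional ℝ H] [MeasurableSpace H] [BorelSpace H]

theorem gaussianLaw_eq_of_mem_covarianceFactors [CompleteSpace F] [SecondCountableTopology F]
    {g : Measure F} [IsGaussian g] {T : H →L[ℝ] F} (hT : T ∈ covarianceFactors H g) :
    gaussianLaw (∫ x, x ∂g) T = g :=
  isGaussian_ext_mean_variance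
    (fun L => by rw [integral_dual_gaussianLaw, IsGaussian.integral_dual])
    fun L => by rw [variance_dual_gaussianLaw, hT L]

theorem exists_isGaussian_map_eq_map [FiniteDimensional ℝ F] [CompleteSpace G]
    [SecondCountableTopology G] {μ : Measure F} [IsFiniteMeasure μ] (hμ : MemLp id 2 μ) :
    ∃ g : Measure F, IsGaussian g ∧
      ∀ S : F →L[ℝ] G, IsGaussian (μ.map S) → g.map S = μ.map S := by
  obtain ⟨T, hT⟩ := covarianceFactors_nonempty hμ
  refine ⟨gaussianLaw (∫ x, x ∂μ) T, inferInstance, fun S hS => ?_⟩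
  have hmean : ∫ y, y ∂(μ.map S) = S (∫ x, x ∂μ) := by
    rw [integral_map (f := fun y => y) S.continuous.aemeasurable aestronglyMeasurable_id]
    exact S.integral_comp_comm (hμ.integrable one_le_two)
  rw [map_gaussianLaw, ← hmean]
  exact gaussianLaw_eq_of_mem_covarianceFactors (comp_mem_covarianceFactors hT S)

end CovarianceFactors

section Gluing

theorem exists_glued_measure {X Y Z : Type*} [MeasurableSpace X] [MeasurableSpace Y]
    [MeasurableSpace Z] [StandardBorelSpace Z] [Nonempty Z] {α : Measure (X × Y)}
    {β : Measure (Y × Z)} [IsProbabilityMeasure α] [IsFiniteMeasure β]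
    (h : α.snd = β.fst) :
    ∃ Γ : Measure ((X × Y) × Z), IsProbabilityMeasure Γ ∧ Γ.map Prod.fst = α ∧
      Γ.map (fun p => (p.1.2, p.2)) = β := by
  refine ⟨α ⊗ₘ (β.condKernel.comap Prod.snd measurable_snd), inferInstance,
    Measure.fst_compProd _ _, ?_⟩
  have hmeas : Measurable (fun p : (X × Y) × Z => (p.1.2, p.2)) := by fun_prop
  conv_rhs => rw [← β.disintegrate β.condKernel, ← h]
  ext s hs
  rw [Measure.map_apply hmeas hs, Measure.compProd_apply (hmeas hs), Measure.compProd_apply hs,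
    Measure.snd, lintegral_map (Kernel.measurable_kernel_prodMk_left hs) measurable_snd]
  rfl

variable {E : Type*} [NormedAddCommGroup E] [NormedSpace ℝ E] [MeasurableSpace E] [BorelSpace E]
  [FiniteDimensional ℝ E]

/-- The projection of a triple to its last two coordinates. -/
def lastTwo (E : Type*) [NormedAddCommGroup E] [NormedSpace ℝ E] : (E × E) × E →L[ℝ] E × E :=
  ((ContinuousLinearMap.snd ℝ E E).comp (.fst ℝ (E × E) E)).prod (.snd ℝ (E × E) E)

theorem exists_glued_isGaussian {α β : Measure (E × E)} [IsGaussian α] [IsGaussian β]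
    (h : α.snd = β.fst) :
    ∃ Γ : Measure ((E × E) × E), IsGaussian Γ ∧ Γ.map (ContinuousLinearMap.fst ℝ (E × E) E) = α ∧
      Γ.map (lastTwo E) = β := by
  obtain ⟨Γ, hΓ, hα, hβ⟩ := exists_glued_measure h
  replace hα : Γ.map (ContinuousLinearMap.fst ℝ (E × E) E) = α := hα
  replace hβ : Γ.map (lastTwo E) = β := hβ
  have hfst : MemLp id 2 (Γ.map (ContinuousLinearMap.fst ℝ (E × E) E)) :=
    hα ▸ IsGaussian.memLp_two_id
  have hlast : MemLp id 2 (Γ.map (lastTwo E)) := hβ ▸ IsGaussian.memLp_two_id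
  have hmem : MemLp id 2 Γ := memLp_prod_iff.2
    ⟨hfst.comp_of_map (by fun_prop), (hlast.comp_of_map (by fun_prop)).snd⟩
  obtain ⟨g, hg, hgmap⟩ := exists_isGaussian_map_eq_map (G := E × E) hmem
  exact ⟨g, hg, (hgmap _ (hα ▸ inferInstance)).trans hα, (hgmap _ (hβ ▸ inferInstance)).trans hβ⟩

end Gluing

section TransportCost

variable {E : Type*} [NormedAddCommGroup E] [MeasurableSpace E]

theorem transportCost_eq_eLpNorm_sq (γ : Measure (E × E)) :
    transportCost γ = eLpNorm (fun z : E × E => z.1 - z.2) 2 γ ^ 2 := by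
  rw [← ENNReal.rpow_ofNat, eLpNorm_eq_lintegral_rpow_enorm_toReal two_ne_zero
    ENNReal.ofNat_ne_top, ENNReal.toReal_ofNat, one_div, ENNReal.rpow_inv_rpow two_ne_zero]
  refine lintegral_congr fun z => ?_
  rw [← ofReal_norm, ENNReal.rpow_ofNat, ENNReal.ofReal_pow (norm_nonneg _)]

theorem transportCost_linearCombination {ι : Type*} (m : ι → Measure (E × E)) (w : ι →₀ ℝ≥0) :
    transportCost (Finsupp.linearCombination ℝ≥0 m w) =
      w.sum fun i r => (r : ℝ≥0∞) * transportCost (m i) :=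
  lintegral_linearCombination m w _

theorem continuous_eLpNorm_const_add_apply {F : Type*} [NormedSpace ℝ E] [NormedAddCommGroup F]
    [NormedSpace ℝ F] [BorelSpace E] {ν : Measure E} [IsFiniteMeasure ν] {p : ℝ≥0∞} (hp : 1 ≤ p)
    (hν : MemLp id p ν) (v : F) :
    Continuous fun T : E →L[ℝ] F => eLpNorm (fun x => v + T x) p ν := by
  refine continuous_of_le_add_edist (eLpNorm id p ν) hν.eLpNorm_ne_top fun S T => ?_
  have hmem : ∀ T : E →L[ℝ] F, MemLp (fun x => T x) p ν := fun T => T.comp_memLp' hν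
  have hdiff : eLpNorm (S - T) p ν ≤ eLpNorm id p ν * edist S T := by
    rw [edist_eq_enorm_sub, mul_comm]
    refine eLpNorm_le_mul_eLpNorm_of_ae_le_mul'' p hν.1 ?_
    exact ae_of_all _ fun x => (S - T).le_opENorm x
  calc eLpNorm (fun x => v + S x) p ν
      = eLpNorm ((fun x => v + T x) + fun x => (S - T) x) p ν := by
        congr 1
        funext x
        simp
    _ ≤ eLpNorm (fun x => v + T x) p ν + eLpNorm (fun x => (S - T) x) p ν :=
        eLpNorm_add_le ((memLp_const v).add (hmem T)).1 (hmem (S - T)).1 hp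
    _ ≤ eLpNorm (fun x => v + T x) p ν + eLpNorm id p ν * edist S T := by gcongr

end TransportCost

section Marginals

variable {E : Type*} [NormedAddCommGroup E] [NormedSpace ℝ E] [MeasurableSpace E] [BorelSpace E]
  [SecondCountableTopology E]

instance isGaussian_fst (γ : Measure (E × E)) [IsGaussian γ] : IsGaussian γ.fst :=
  inferInstanceAs (IsGaussian (γ.map (ContinuousLinearMap.fst ℝ E E)))

instance isGaussian_snd (γ : Measure (E × E)) [IsGaussian γ] : IsGaussian γ.snd :=
  inferInstanceAs (IsGaussian (γ.map (ContinuousLinearMap.snd ℝ E E)))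

end Marginals

section OptimalGaussianPlan

variable {E H : Type*} [NormedAddCommGroup E] [NormedSpace ℝ E] [MeasurableSpace E] [BorelSpace E]
  [FiniteDimensional ℝ E] [NormedAddCommGroup H] [InnerProductSpace ℝ H] [FiniteDimensional ℝ H]
  [MeasurableSpace H] [BorelSpace H]

theorem transportCost_gaussianLaw_prod (m : E × E) (T S : H →L[ℝ] E) :
    transportCost (gaussianLaw m (T.prod S)) =
      eLpNorm (fun x => m.1 - m.2 + (T - S) x) 2 (stdGaussian H) ^ 2 := by
  rw [transportCost_eq_eLpNorm_sq, gaussianLaw, eLpNorm_map_measure (by fun_prop) (by fun_prop)]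
  congr 2
  funext x
  simp [add_sub_add_comm]

theorem fst_gaussianLaw_prod (q : Measure E) {p : Measure E} [IsGaussian p] {T : H →L[ℝ] E}
    (hT : T ∈ covarianceFactors H p) (S : H →L[ℝ] E) :
    (gaussianLaw (∫ x, x ∂p, ∫ x, x ∂q) (T.prod S)).fst = p :=
  (map_gaussianLaw _ _ (ContinuousLinearMap.fst ℝ E E)).trans
    (gaussianLaw_eq_of_mem_covarianceFactors hT)

theorem snd_gaussianLaw_prod (p : Measure E) {q : Measure E} [IsGaussian q] (T : H →L[ℝ] E)
    {S : H →L[ℝ] E} (hS : S ∈ covarianceFactors H q) :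
    (gaussianLaw (∫ x, x ∂p, ∫ x, x ∂q) (T.prod S)).snd = q :=
  (map_gaussianLaw _ _ (ContinuousLinearMap.snd ℝ E E)).trans
    (gaussianLaw_eq_of_mem_covarianceFactors hS)

theorem exists_gaussianLaw_prod_eq (γ : Measure (E × E)) [IsGaussian γ] :
    let H := EuclideanSpace ℝ (Fin (Module.finrank ℝ (E × E)))
    ∃ T ∈ covarianceFactors H γ.fst, ∃ S ∈ covarianceFactors H γ.snd,
      gaussianLaw (∫ x, x ∂γ.fst, ∫ x, x ∂γ.snd) (T.prod S) = γ := by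
  have hγ : MemLp id 2 γ := IsGaussian.memLp_two_id
  obtain ⟨R, hR⟩ := covarianceFactors_nonempty hγ
  have hint : Integrable (fun z : E × E => z) γ := hγ.integrable one_le_two
  have hmean : (∫ x, x ∂γ.fst, ∫ x, x ∂γ.snd) = ∫ z, z ∂γ := by
    rw [Measure.fst, Measure.snd, integral_map (by fun_prop) (by fun_prop),
      integral_map (by fun_prop) (by fun_prop)]
    exact Prod.ext (fst_integral hint).symm (snd_integral hint).symm
  refine ⟨(ContinuousLinearMap.fst ℝ E E).comp R, comp_mem_covarianceFactors hR _,
    (ContinuousLinearMap.snd ℝ E E).comp R, comp_mem_covarianceFactors hR _, ?_⟩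
  rw [hmean]
  exact gaussianLaw_eq_of_mem_covarianceFactors hR

theorem exists_optimal_gaussian_plan (p q : Measure E) [IsGaussian p] [IsGaussian q] :
    ∃ γ : Measure (E × E), IsGaussian γ ∧ γ.fst = p ∧ γ.snd = q ∧
      ∀ γ' : Measure (E × E), IsGaussian γ' → γ'.fst = p → γ'.snd = q →
        transportCost γ ≤ transportCost γ' := by
  let H := EuclideanSpace ℝ (Fin (Module.finrank ℝ (E × E)))
  have hne : (covarianceFactors H p ×ˢ covarianceFactors H q).Nonempty := by
    obtain ⟨T, hT, S, hS, -⟩ := exists_gaussianLaw_prod_eq (p.prod q)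
    rw [Measure.fst_prod] at hT
    rw [Measure.snd_prod] at hS
    exact ⟨(T, S), hT, hS⟩
  have hcompact : IsCompact (covarianceFactors H p ×ˢ covarianceFactors H q) :=
    (isCompact_covarianceFactors IsGaussian.memLp_two_id).prod
      (isCompact_covarianceFactors IsGaussian.memLp_two_id)
  have hcont : Continuous fun T : (H →L[ℝ] E) × (H →L[ℝ] E) =>
      eLpNorm (fun x => ∫ x, x ∂p - ∫ x, x ∂q + (T.1 - T.2) x) 2 (stdGaussian H) :=
    (continuous_eLpNorm_const_add_apply one_le_two IsGaussian.memLp_two_id _).comp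
      (continuous_fst.sub continuous_snd)
  obtain ⟨⟨T, S⟩, ⟨hT, hS⟩, hmin⟩ := hcompact.exists_isMinOn hne hcont.continuousOn
  refine ⟨gaussianLaw (∫ x, x ∂p, ∫ x, x ∂q) (T.prod S), inferInstance,
    fst_gaussianLaw_prod q hT S, snd_gaussianLaw_prod p T hS, ?_⟩
  rintro γ' hγ' rfl rfl
  obtain ⟨T', hT', S', hS', hγ'_eq⟩ := exists_gaussianLaw_prod_eq γ'
  conv_rhs => rw [← hγ'_eq]
  rw [transportCost_gaussianLaw_prod, transportCost_gaussianLaw_prod]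
  exact pow_le_pow_left' (hmin (a := (T', S')) ⟨hT', hS'⟩) 2

end OptimalGaussianPlan

section WeightCouplings

variable {A B C : Type*}

/-- The couplings of two families of weights: the transport polytope of the discrete optimal
transport problem between `a` and `b`. -/
def weightCouplings (a : A →₀ ℝ≥0) (b : B →₀ ℝ≥0) : Set (A × B →₀ ℝ≥0) :=
  {t | t.mapDomain Prod.fst = a ∧ t.mapDomain Prod.snd = b}

theorem le_mapDomain_apply (t : A →₀ ℝ≥0) (f : A → C) (x : A) : t x ≤ t.mapDomain f (f x) := by
  classical
  rw [Finsupp.mapDomain_apply_eq_sum]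
  by_cases hx : x ∈ t.support
  · exact Finset.single_le_sum (f := t) (fun _ _ => zero_le) (Finset.mem_filter.2 ⟨hx, rfl⟩)
  · rw [Finsupp.notMem_support_iff.1 hx]
    exact zero_le

theorem mapDomain_fst_apply {t : A × B →₀ ℝ≥0} {u : Finset B} (h : ∀ p ∈ t.support, p.2 ∈ u)
    (x : A) : t.mapDomain Prod.fst x = ∑ y ∈ u, t (x, y) := by
  classical
  have hsub : t.support ⊆ t.support.image Prod.fst ×ˢ u := fun p hp =>
    Finset.mem_product.2 ⟨Finset.mem_image_of_mem _ hp, h p hp⟩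
  rw [Finsupp.mapDomain, Finsupp.sum_of_support_subset _ hsub _ (by simp), Finsupp.finsetSum_apply,
    Finset.sum_product_right]
  refine Finset.sum_congr rfl fun y _ => ?_
  simp only [Finsupp.single_apply, Finset.sum_ite_eq', ite_eq_left_iff]
  intro hx
  by_contra hxy
  exact hx (Finset.mem_image_of_mem Prod.fst (Finsupp.mem_support_iff.2 (Ne.symm hxy)))

theorem mapDomain_snd_apply {t : A × B →₀ ℝ≥0} {s : Finset A} (h : ∀ p ∈ t.support, p.1 ∈ s)
    (y : B) : t.mapDomain Prod.snd y = ∑ x ∈ s, t (x, y) := by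
  classical
  have hswap : ∀ p ∈ (t.mapDomain Prod.swap).support, p.2 ∈ s := fun p hp => by
    obtain ⟨q, hq, rfl⟩ := Finset.mem_image.1 (Finsupp.mapDomain_support hp)
    exact h q hq
  have hfst := mapDomain_fst_apply hswap y
  rw [← Finsupp.mapDomain_comp] at hfst
  exact hfst.trans (Finset.sum_congr rfl fun x _ =>
    Finsupp.mapDomain_apply Prod.swap_injective t (x, y))

theorem mem_support_of_mem_weightCouplings {a : A →₀ ℝ≥0} {b : B →₀ ℝ≥0} {t : A × B →₀ ℝ≥0}
    (ht : t ∈ weightCouplings a b) {p : A × B} (hp : p ∈ t.support) :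
    p.1 ∈ a.support ∧ p.2 ∈ b.support := by
  simp only [Finsupp.mem_support_iff, ← pos_iff_ne_zero] at hp ⊢
  rw [← ht.1, ← ht.2]
  exact ⟨hp.trans_le (le_mapDomain_apply t _ p), hp.trans_le (le_mapDomain_apply t _ p)⟩

theorem mem_weightCouplings_iff_sum {a : A →₀ ℝ≥0} {b : B →₀ ℝ≥0} {t : A × B →₀ ℝ≥0}
    (h : t.support ⊆ a.support ×ˢ b.support) :
    t ∈ weightCouplings a b ↔
      (∀ x, ∑ y ∈ b.support, t (x, y) = a x) ∧ ∀ y, ∑ x ∈ a.support, t (x, y) = b y := by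
  have hrow := mapDomain_fst_apply fun p hp => (Finset.mem_product.1 (h hp)).2
  have hcol := mapDomain_snd_apply fun p hp => (Finset.mem_product.1 (h hp)).1
  simp only [weightCouplings, Set.mem_ofPred_eq, Finsupp.ext_iff, hrow, hcol]

theorem sum_ite_mul_div_mapDomain [DecidableEq C] {b : B →₀ ℝ≥0} {g : B → C} {z : C} {r : ℝ≥0}
    (hr : r ≤ b.mapDomain g z) :
    ∑ y ∈ b.support, (if z = g y then r * b y / b.mapDomain g z else 0) = r := by
  have hsum : ∑ y ∈ b.support, (if z = g y then b y else 0) = b.mapDomain g z := by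
    simp only [Finsupp.mapDomain, Finsupp.sum, Finsupp.finsetSum_apply, Finsupp.single_apply,
      eq_comm]
  calc ∑ y ∈ b.support, (if z = g y then r * b y / b.mapDomain g z else 0)
      = r * b.mapDomain g z / b.mapDomain g z := by
        conv_rhs => rw [← hsum, Finset.mul_sum, Finset.sum_div, hsum]
        simp only [mul_ite, mul_zero, ite_div, zero_div]
    _ = r := mul_div_cancel_of_imp fun h => le_antisymm (hr.trans_eq h) zero_le

theorem exists_weightCoupling_of_mapDomain_eq {a : A →₀ ℝ≥0} {b : B →₀ ℝ≥0} {f : A → C}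
    {g : B → C} (h : a.mapDomain f = b.mapDomain g) :
    ∃ t ∈ weightCouplings a b, ∀ p ∈ t.support, f p.1 = g p.2 := by
  classical
  -- Over each point of `C`, take the product of the two conditional distributions.
  let τ : A × B → ℝ≥0 := fun p =>
    if f p.1 = g p.2 then a p.1 * b p.2 / b.mapDomain g (f p.1) else 0
  have hτ : ∀ p, τ p ≠ 0 → f p.1 = g p.2 ∧ p ∈ a.support ×ˢ b.support := fun p hp => by
    obtain ⟨hfg, hne⟩ := ite_ne_right_iff.1 hp
    obtain ⟨hab, -⟩ := div_ne_zero_iff.1 hne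
    obtain ⟨ha, hb⟩ := mul_ne_zero_iff.1 hab
    exact ⟨hfg, by simp [ha, hb]⟩
  let t : A × B →₀ ℝ≥0 := .onFinset (a.support ×ˢ b.support) τ fun p hp => (hτ p hp).2
  refine ⟨t, (mem_weightCouplings_iff_sum Finsupp.support_onFinset_subset).2
    ⟨fun x => ?_, fun y => ?_⟩, fun p hp => (hτ p (Finsupp.mem_support_iff.1 hp)).1⟩
  · exact sum_ite_mul_div_mapDomain (h ▸ le_mapDomain_apply a f x)
  · rw [← sum_ite_mul_div_mapDomain (h ▸ le_mapDomain_apply b g y : b y ≤ a.mapDomain f (g y))]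
    refine Finset.sum_congr rfl fun x _ => ?_
    simp only [τ, Finsupp.onFinset_apply, eq_comm (a := g y)]
    split_ifs with hxy
    · rw [h, hxy, mul_comm]
    · rfl

theorem weightCouplings_nonempty {a : A →₀ ℝ≥0} {b : B →₀ ℝ≥0} (h : a.degree = b.degree) :
    (weightCouplings a b).Nonempty := by
  have hmass : (a.mapDomain fun _ => ()).degree = (b.mapDomain fun _ => ()).degree := by
    rw [Finsupp.degree_mapDomain, Finsupp.degree_mapDomain, h]
  obtain ⟨t, ht, -⟩ := exists_weightCoupling_of_mapDomain_eq (a := a) (b := b)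
    (f := fun _ => ()) (g := fun _ => ())
    (Finsupp.unique_ext (by simpa only [Finsupp.degree_eq_sum, Fintype.sum_unique] using hmass))
  exact ⟨t, ht⟩

theorem isCompact_image_weightCouplings (a : A →₀ ℝ≥0) (b : B →₀ ℝ≥0) :
    IsCompact ((fun t : A × B →₀ ℝ≥0 => (t : A × B → ℝ≥0)) '' weightCouplings a b) := by
  have himage : (fun t : A × B →₀ ℝ≥0 => (t : A × B → ℝ≥0)) '' weightCouplings a b =
      (Set.univ.pi fun p => Set.Icc 0 (min (a p.1) (b p.2))) ∩
        ({τ | ∀ x, ∑ y ∈ b.support, τ (x, y) = a x} ∩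
          {τ | ∀ y, ∑ x ∈ a.support, τ (x, y) = b y}) := by
    refine Set.Subset.antisymm ?_ ?_
    · rintro _ ⟨t, ht, rfl⟩
      exact ⟨fun p _ => ⟨zero_le, le_min (ht.1 ▸ le_mapDomain_apply t Prod.fst p)
        (ht.2 ▸ le_mapDomain_apply t Prod.snd p)⟩, (mem_weightCouplings_iff_sum fun p hp =>
          Finset.mem_product.2 (mem_support_of_mem_weightCouplings ht hp)).1 ht⟩
    · rintro τ ⟨hle, hsum⟩
      have hsupp : ∀ p, τ p ≠ 0 → p ∈ a.support ×ˢ b.support := fun p hp => by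
        have hpos := (pos_iff_ne_zero.2 hp).trans_le (hle p trivial).2
        rw [lt_min_iff] at hpos
        simp [hpos.1.ne', hpos.2.ne']
      exact ⟨.onFinset _ τ hsupp,
        (mem_weightCouplings_iff_sum Finsupp.support_onFinset_subset).2 hsum, rfl⟩
  rw [himage]
  refine (isCompact_univ_pi fun _ => isCompact_Icc).inter_right (IsClosed.inter ?_ ?_)
  · simp only [Set.ofPred_forall]
    exact isClosed_iInter fun x => isClosed_eq (by fun_prop) continuous_const
  · simp only [Set.ofPred_forall]
    exact isClosed_iInter fun y => isClosed_eq (by fun_prop) continuous_const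

theorem exists_optimal_weightCoupling {a : A →₀ ℝ≥0} {b : B →₀ ℝ≥0} (h : a.degree = b.degree)
    {c : A × B → ℝ≥0∞} (hc : ∀ p, c p ≠ ∞) :
    ∃ t ∈ weightCouplings a b, ∀ t' ∈ weightCouplings a b,
      t.sum (fun p r => (r : ℝ≥0∞) * c p) ≤ t'.sum fun p r => (r : ℝ≥0∞) * c p := by
  have hcont : Continuous fun τ : A × B → ℝ≥0 =>
      ∑ p ∈ a.support ×ˢ b.support, (τ p : ℝ≥0∞) * c p :=
    continuous_finsetSum _ fun p _ => (ENNReal.continuous_mul_const (hc p)).comp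
      (ENNReal.continuous_coe.comp (continuous_apply p))
  have hsum : ∀ t ∈ weightCouplings a b, t.sum (fun p r => (r : ℝ≥0∞) * c p) =
      ∑ p ∈ a.support ×ˢ b.support, (t p : ℝ≥0∞) * c p := fun t ht =>
    Finsupp.sum_of_support_subset _ (fun p hp =>
      Finset.mem_product.2 (mem_support_of_mem_weightCouplings ht hp)) _ (by simp)
  obtain ⟨_, ⟨t, ht, rfl⟩, hmin⟩ := (isCompact_image_weightCouplings a b).exists_isMinOn
    ((weightCouplings_nonempty h).image _) hcont.continuousOn
  refine ⟨t, ht, fun t' ht' => ?_⟩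
  rw [hsum t ht, hsum t' ht']
  exact hmin ⟨t', ht', rfl⟩

end WeightCouplings

section Mixtures

variable {E F : Type*} [NormedAddCommGroup E] [NormedSpace ℝ E] [MeasurableSpace E]
  [NormedAddCommGroup F] [NormedSpace ℝ F] [MeasurableSpace F]

theorem linearCombination_mem_GMM {ι : Type*} {w : ι →₀ ℝ≥0} {m : ι → Measure E}
    (hm : ∀ i ∈ w.support, IsGaussian (m i)) (hw : w.degree = 1) :
    Finsupp.linearCombination ℝ≥0 m w ∈ GMM E := by
  let e := w.support.equivFin.symm
  refine Set.mem_iUnion.2 ⟨w.support.card, fun k => w (e k), fun k => m (e k), ?_,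
    fun k => hm _ (e k).2, ?_⟩
  · rw [e.sum_comp (fun i : w.support => w i), Finset.sum_coe_sort w.support w]
    exact hw
  · rw [e.sum_comp (fun i : w.support => w i • m i),
      Finset.sum_coe_sort w.support (fun i => w i • m i)]
    rfl

theorem exists_weights_of_mem_GMM {μ : Measure E} (hμ : μ ∈ GMM E) :
    ∃ w : GaussianMeasure E →₀ ℝ≥0,
      Finsupp.linearCombination ℝ≥0 Subtype.val w = μ ∧ w.degree = 1 := by
  obtain ⟨K, π, g, hπ, hg, rfl⟩ := Set.mem_iUnion.1 hμ
  refine ⟨∑ k, Finsupp.single ⟨g k, hg k⟩ (π k), ?_, ?_⟩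
  · simp only [map_sum, Finsupp.linearCombination_single]
  · simpa only [map_sum, Finsupp.degree_single] using hπ

variable [BorelSpace E]

theorem map_mem_GMM [BorelSpace F] {μ : Measure E} (hμ : μ ∈ GMM E) (T : E →L[ℝ] F) :
    μ.map T ∈ GMM F := by
  obtain ⟨w, rfl, hw⟩ := exists_weights_of_mem_GMM hμ
  rw [map_linearCombination _ _ T.continuous.measurable]
  exact linearCombination_mem_GMM (fun g _ => inferInstance) hw

variable [FiniteDimensional ℝ E]

theorem exists_glued_mixture {α β : Measure (E × E)} (hα : α ∈ GMM (E × E))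
    (hβ : β ∈ GMM (E × E)) (h : α.snd = β.fst) :
    ∃ Γ ∈ GMM ((E × E) × E), Γ.map (ContinuousLinearMap.fst ℝ (E × E) E) = α ∧
      Γ.map (lastTwo E) = β := by
  obtain ⟨a, rfl, ha⟩ := exists_weights_of_mem_GMM hα
  obtain ⟨b, rfl, -⟩ := exists_weights_of_mem_GMM hβ
  have hmiddle : a.mapDomain (GaussianMeasure.map (.snd ℝ E E)) =
      b.mapDomain (GaussianMeasure.map (.fst ℝ E E)) :=
    mapDomain_map_eq_of_map_linearCombination (h.trans
      (map_linearCombination_eq_mapDomain measurable_fst fun _ _ => rfl))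
  obtain ⟨t, ⟨hta, htb⟩, ht⟩ := exists_weightCoupling_of_mapDomain_eq hmiddle
  choose! G hG hGα hGβ using fun p (hp : p ∈ t.support) =>
    exists_glued_isGaussian (congrArg Subtype.val (ht p hp))
  refine ⟨Finsupp.linearCombination ℝ≥0 G t, linearCombination_mem_GMM hG ?_, ?_, ?_⟩
  · rw [← ha, ← hta, Finsupp.degree_mapDomain]
  · rw [← hta]
    exact map_linearCombination_eq_mapDomain (by fun_prop) hGα
  · rw [← htb]
    exact map_linearCombination_eq_mapDomain (by fun_prop) hGβ

end Mixtures

section Plans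

variable {E : Type*} [NormedAddCommGroup E] [NormedSpace ℝ E] [MeasurableSpace E]

theorem linearCombination_mem_gmmPlans {a b : GaussianMeasure E →₀ ℝ≥0} (ha : a.degree = 1)
    {t : GaussianMeasure E × GaussianMeasure E →₀ ℝ≥0} (ht : t ∈ weightCouplings a b)
    {G : GaussianMeasure E × GaussianMeasure E → Measure (E × E)} (hG : ∀ p, IsGaussian (G p))
    (hfst : ∀ p, (G p).fst = p.1) (hsnd : ∀ p, (G p).snd = p.2) :
    Finsupp.linearCombination ℝ≥0 G t ∈ gmmPlans (Finsupp.linearCombination ℝ≥0 Subtype.val a)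
      (Finsupp.linearCombination ℝ≥0 Subtype.val b) := by
  obtain ⟨rfl, rfl⟩ := ht
  rw [Finsupp.degree_mapDomain] at ha
  exact ⟨⟨map_linearCombination_eq_mapDomain measurable_fst fun p _ => hfst p,
    map_linearCombination_eq_mapDomain measurable_snd fun p _ => hsnd p⟩,
    linearCombination_mem_GMM (fun p _ => hG p) ha⟩

theorem MW₂_eq_iInf_eLpNorm (μ ν : Measure E) :
    MW₂ μ ν = ⨅ γ ∈ gmmPlans μ ν, eLpNorm (fun z : E × E => z.1 - z.2) 2 γ := by
  have hroot (c : ℝ≥0∞) : (c ^ 2) ^ (1 / 2 : ℝ) = c := by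
    rw [one_div, ← ENNReal.rpow_ofNat, ENNReal.rpow_rpow_inv two_ne_zero]
  have hinf := (ENNReal.orderIsoRpow (1 / 2) one_half_pos).map_iInf₂
    fun γ (_ : γ ∈ gmmPlans μ ν) => transportCost γ
  refine hinf.trans (iInf_congr fun γ => iInf_congr fun _ => ?_)
  rw [transportCost_eq_eLpNorm_sq]
  exact hroot _

theorem IsOptimalPlan.MW₂_eq {μ ν : Measure E} {γ : Measure (E × E)} (h : IsOptimalPlan μ ν γ) :
    MW₂ μ ν = eLpNorm (fun z : E × E => z.1 - z.2) 2 γ := by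
  rw [MW₂_eq_iInf_eLpNorm]
  refine le_antisymm (iInf₂_le γ h.1) (le_iInf₂ fun γ' hγ' => ?_)
  have hcost := h.2 γ' hγ'
  rwa [transportCost_eq_eLpNorm_sq, transportCost_eq_eLpNorm_sq,
    ENNReal.pow_le_pow_left_iff two_ne_zero] at hcost

variable [BorelSpace E] [SecondCountableTopology E]

theorem MW₂_map_le {F : Type*} [NormedAddCommGroup F] [NormedSpace ℝ F] [MeasurableSpace F]
    [BorelSpace F] {μ : Measure F} (hμ : μ ∈ GMM F) (T S : F →L[ℝ] E) :
    MW₂ (μ.map T) (μ.map S) ≤ eLpNorm (fun x => T x - S x) 2 μ := by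
  have hplan : μ.map (T.prod S) ∈ gmmPlans (μ.map T) (μ.map S) :=
    ⟨⟨Measure.fst_map_prodMk (by fun_prop), Measure.snd_map_prodMk (by fun_prop)⟩,
      map_mem_GMM hμ (T.prod S)⟩
  rw [MW₂_eq_iInf_eLpNorm]
  refine (iInf₂_le _ hplan).trans_eq ?_
  rw [eLpNorm_map_measure (by fun_prop) (by fun_prop)]
  rfl

theorem MW₂_self {μ : Measure E} (hμ : μ ∈ GMM E) : MW₂ μ μ = 0 := by
  have h := MW₂_map_le hμ (.id ℝ E) (.id ℝ E)
  simpa using h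

theorem MW₂_comm (μ ν : Measure E) : MW₂ μ ν = MW₂ ν μ := by
  suffices h : ∀ μ ν : Measure E, MW₂ ν μ ≤ MW₂ μ ν from le_antisymm (h ν μ) (h μ ν)
  intro μ ν
  rw [MW₂_eq_iInf_eLpNorm μ ν]
  refine le_iInf₂ ?_
  rintro γ ⟨⟨rfl, rfl⟩, hγ⟩
  refine (MW₂_map_le hγ (.snd ℝ E E) (.fst ℝ E E)).trans_eq ?_
  exact eLpNorm_sub_comm _ _ _ _

variable [CompleteSpace E]

theorem transportCost_ne_top_of_isGaussian (γ : Measure (E × E)) [IsGaussian γ] :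
    transportCost γ ≠ ∞ := by
  have hmem : MemLp (fun z : E × E => z.1 - z.2) 2 γ :=
    (ContinuousLinearMap.fst ℝ E E - ContinuousLinearMap.snd ℝ E E).comp_memLp'
      IsGaussian.memLp_two_id
  rw [transportCost_eq_eLpNorm_sq]
  exact ENNReal.pow_ne_top hmem.eLpNorm_ne_top

theorem transportCost_ne_top {γ : Measure (E × E)} (hγ : γ ∈ GMM (E × E)) :
    transportCost γ ≠ ∞ := by
  obtain ⟨w, rfl, -⟩ := exists_weights_of_mem_GMM hγ
  rw [transportCost_linearCombination]
  exact ENNReal.sum_ne_top.2 fun g _ =>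
    ENNReal.mul_ne_top ENNReal.coe_ne_top (transportCost_ne_top_of_isGaussian g.1)

/-- The two marginals of a Gaussian plan. -/
noncomputable def GaussianMeasure.marginals (γ : GaussianMeasure (E × E)) :
    GaussianMeasure E × GaussianMeasure E :=
  (γ.map (.fst ℝ E E), γ.map (.snd ℝ E E))

theorem mapDomain_marginals_mem_weightCouplings {W : GaussianMeasure (E × E) →₀ ℝ≥0}
    {a b : GaussianMeasure E →₀ ℝ≥0}
    (hfst : (Finsupp.linearCombination ℝ≥0 Subtype.val W).fst =
      Finsupp.linearCombination ℝ≥0 Subtype.val a)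
    (hsnd : (Finsupp.linearCombination ℝ≥0 Subtype.val W).snd =
      Finsupp.linearCombination ℝ≥0 Subtype.val b) :
    W.mapDomain GaussianMeasure.marginals ∈ weightCouplings a b := by
  constructor <;> rw [← Finsupp.mapDomain_comp]
  exacts [mapDomain_map_eq_of_map_linearCombination hfst,
    mapDomain_map_eq_of_map_linearCombination hsnd]

end Plans

section MixtureDistance

variable {E : Type*} [NormedAddCommGroup E] [NormedSpace ℝ E] [MeasurableSpace E] [BorelSpace E]
  [FiniteDimensional ℝ E]

theorem MW₂_triangle (μ₀ μ₁ μ₂ : Measure E) : MW₂ μ₀ μ₂ ≤ MW₂ μ₀ μ₁ + MW₂ μ₁ μ₂ := by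
  rw [MW₂_eq_iInf_eLpNorm μ₀ μ₁, MW₂_eq_iInf_eLpNorm μ₁ μ₂]
  refine ENNReal.le_iInf₂_add_iInf₂ ?_
  rintro α ⟨⟨rfl, hα⟩, hαG⟩ β ⟨⟨hβ, rfl⟩, hβG⟩
  obtain ⟨Γ, hΓ, rfl, rfl⟩ := exists_glued_mixture hαG hβG (hα.trans hβ.symm)
  let T := (ContinuousLinearMap.fst ℝ E E).comp (.fst ℝ (E × E) E)
  let S := ContinuousLinearMap.snd ℝ (E × E) E
  have hT : (Γ.map (ContinuousLinearMap.fst ℝ (E × E) E)).fst = Γ.map T :=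
    Measure.map_map (by fun_prop) (by fun_prop)
  have hS : (Γ.map (lastTwo E)).snd = Γ.map S := Measure.map_map (by fun_prop) (by fun_prop)
  rw [hT, hS, eLpNorm_map_measure (by fun_prop) (by fun_prop),
    eLpNorm_map_measure (by fun_prop) (by fun_prop)]
  calc MW₂ (Γ.map T) (Γ.map S) ≤ eLpNorm (fun p => T p - S p) 2 Γ := MW₂_map_le hΓ T S
    _ = eLpNorm (fun p : (E × E) × E => (p.1.1 - p.1.2) + (p.1.2 - p.2)) 2 Γ := by
      simp only [sub_add_sub_cancel]; rfl
    _ ≤ _ := eLpNorm_add_le (by fun_prop) (by fun_prop) one_le_two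

theorem exists_isOptimalPlan {μ ν : Measure E} (hμ : μ ∈ GMM E) (hν : ν ∈ GMM E) :
    ∃ γ, IsOptimalPlan μ ν γ := by
  obtain ⟨a, rfl, ha⟩ := exists_weights_of_mem_GMM hμ
  obtain ⟨b, rfl, hb⟩ := exists_weights_of_mem_GMM hν
  choose G hG hfst hsnd hmin using fun p : GaussianMeasure E × GaussianMeasure E =>
    exists_optimal_gaussian_plan p.1.1 p.2.1
  obtain ⟨t, ht, htmin⟩ := exists_optimal_weightCoupling (ha.trans hb.symm)
    fun p => transportCost_ne_top_of_isGaussian (G p)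
  refine ⟨_, linearCombination_mem_gmmPlans ha ht hG hfst hsnd, ?_⟩
  rintro γ ⟨⟨hγa, hγb⟩, hγ⟩
  obtain ⟨W, rfl, -⟩ := exists_weights_of_mem_GMM hγ
  rw [transportCost_linearCombination, transportCost_linearCombination]
  calc t.sum (fun p r => (r : ℝ≥0∞) * transportCost (G p))
      ≤ (W.mapDomain GaussianMeasure.marginals).sum fun p r => r * transportCost (G p) :=
        htmin _ (mapDomain_marginals_mem_weightCouplings hγa hγb)
    _ = W.sum fun g r => r * transportCost (G g.marginals) :=
        Finsupp.sum_mapDomain_index (by simp) (by simp [add_mul])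
    _ ≤ W.sum fun g r => r * transportCost g.1 :=
        Finset.sum_le_sum fun g _ => mul_le_mul_right (hmin _ g.1 g.2 rfl rfl) _

theorem MW₂_ne_top {μ ν : Measure E} (hμ : μ ∈ GMM E) (hν : ν ∈ GMM E) : MW₂ μ ν ≠ ∞ := by
  obtain ⟨γ, hγ⟩ := exists_isOptimalPlan hμ hν
  have hcost := transportCost_ne_top hγ.1.2
  rw [transportCost_eq_eLpNorm_sq, ← hγ.MW₂_eq] at hcost
  exact fun h => hcost (h ▸ ENNReal.top_pow two_ne_zero)

theorem eq_of_MW₂_eq_zero {μ ν : Measure E} (hμ : μ ∈ GMM E) (hν : ν ∈ GMM E)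
    (h : MW₂ μ ν = 0) : μ = ν := by
  obtain ⟨γ, hγ⟩ := exists_isOptimalPlan hμ hν
  rw [hγ.MW₂_eq, eLpNorm_eq_zero_iff (by fun_prop) two_ne_zero] at h
  have hdiag : (Prod.fst : E × E → E) =ᵐ[γ] Prod.snd := h.mono fun z hz => sub_eq_zero.1 hz
  rw [← hγ.1.1.1, ← hγ.1.1.2, Measure.fst, Measure.snd, Measure.map_congr hdiag]

/-- Finite Gaussian mixtures with the extended distance `MW₂`. -/
@[reducible]
noncomputable def gmmEMetricSpace (E : Type*) [NormedAddCommGroup E] [NormedSpace ℝ E]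
    [MeasurableSpace E] [BorelSpace E] [FiniteDimensional ℝ E] : EMetricSpace (GMM E) where
  edist μ ν := MW₂ μ.1 ν.1
  edist_self μ := MW₂_self μ.2
  edist_comm μ ν := MW₂_comm μ.1 ν.1
  edist_triangle μ₀ μ₁ μ₂ := MW₂_triangle μ₀.1 μ₁.1 μ₂.1
  eq_of_edist_eq_zero {μ ν} h := Subtype.ext (eq_of_MW₂_eq_zero μ.2 ν.2 h)

/-- Finite Gaussian mixtures with the finite distance `MW₂`, arranged so that `edist` is `MW₂` by
definition. -/
@[reducible]
noncomputable def gmmMetricSpace (E : Type*) [NormedAddCommGroup E] [NormedSpace ℝ E]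
    [MeasurableSpace E] [BorelSpace E] [FiniteDimensional ℝ E] : MetricSpace (GMM E) :=
  letI := gmmEMetricSpace E
  EMetricSpace.toMetricSpace fun μ ν => MW₂_ne_top μ.2 ν.2

end MixtureDistance

section ConstantSpeed

variable {X : Type*} [MetricSpace X] {x y : X} {ρ : Path x y}

theorem isConstantSpeedGeodesic_of_dist_le
    (h : ∀ s t : I, dist (ρ s) (ρ t) ≤ |(t : ℝ) - s| * dist x y) : IsConstantSpeedGeodesic ρ := by
  -- The three bounds on `[0, s]`, `[s, t]` and `[t, 1]` add up to `dist x y`, so all are sharp.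
  have hsharp : ∀ s t : I, s ≤ t → |(t : ℝ) - s| * dist x y ≤ dist (ρ s) (ρ t) := by
    intro s t hst
    have hleft := h 0 s
    have hright := h t 1
    have htri := dist_triangle4 x (ρ s) (ρ t) y
    rw [ρ.source, Set.Icc.coe_zero, sub_zero, abs_of_nonneg s.2.1] at hleft
    rw [ρ.target, Set.Icc.coe_one, abs_of_nonneg (sub_nonneg.2 t.2.2)] at hright
    rw [abs_of_nonneg (sub_nonneg.2 (Subtype.coe_le_coe.2 hst))]
    linarith
  intro s t
  refine le_antisymm (h s t) ?_
  rcases le_total s t with hst | hts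
  · exact hsharp s t hst
  · rw [dist_comm (ρ s), abs_sub_comm]
    exact hsharp t s hts

theorem edist_le_pathLength (ρ : Path x y) : edist x y ≤ pathLength ρ := by
  have h := eVariationOn.edist_le ρ (Set.mem_univ (0 : I)) (Set.mem_univ (1 : I))
  rwa [ρ.source, ρ.target] at h

theorem pathLength_le_of_lipschitzWith {K : ℝ≥0} (h : LipschitzWith K ρ) : pathLength ρ ≤ K := by
  have hI : eVariationOn (id : I → I) Set.univ = 1 := by
    have h01 := ((Subtype.mono_coe _).monotoneOn Set.univ).eVariationOn_eq
      (Set.mem_univ (0 : I)) (Set.mem_univ 1)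
    rw [Set.univ_inter, ← unitInterval.univ_eq_Icc] at h01
    exact h01.trans (by simp)
  calc pathLength ρ ≤ K * eVariationOn (id : I → I) Set.univ :=
        (h.lipschitzOnWith (s := Set.univ)).comp_eVariationOn_le (Set.mapsTo_univ _ _)
    _ = K := by rw [hI, mul_one]

theorem IsConstantSpeedGeodesic.pathLength_eq (h : IsConstantSpeedGeodesic ρ) :
    pathLength ρ = edist x y := by
  refine le_antisymm ?_ (edist_le_pathLength ρ)
  rw [edist_nndist]
  refine pathLength_le_of_lipschitzWith (LipschitzWith.of_dist_le_mul fun s t => ?_)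
  rw [h s t, coe_nndist, mul_comm, dist_comm s, Subtype.dist_eq, Real.dist_eq]

end ConstantSpeed

section Geodesics

variable {E : Type*} [NormedAddCommGroup E] [NormedSpace ℝ E]

/-- The interpolation map `interp t` as a continuous linear map, so that it pushes Gaussian
mixtures to Gaussian mixtures. -/
def interpCLM (E : Type*) [NormedAddCommGroup E] [NormedSpace ℝ E] (t : ℝ) : E × E →L[ℝ] E :=
  (1 - t) • ContinuousLinearMap.fst ℝ E E + t • ContinuousLinearMap.snd ℝ E E

theorem interp_sub_interp (s t : ℝ) (z : E × E) :
    interp s z - interp t z = (t - s) • (z.1 - z.2) := by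
  simp only [interp]
  module

variable [MeasurableSpace E]

theorem map_interp_zero (γ : Measure (E × E)) : γ.map (interp 0) = γ.fst :=
  congrArg γ.map (funext fun z => by simp [interp])

theorem map_interp_one (γ : Measure (E × E)) : γ.map (interp 1) = γ.snd :=
  congrArg γ.map (funext fun z => by simp [interp])

theorem MW₂_map_interp_le [BorelSpace E] [SecondCountableTopology E] {γ : Measure (E × E)}
    (hγ : γ ∈ GMM (E × E)) (s t : ℝ) :
    MW₂ (γ.map (interp s)) (γ.map (interp t)) ≤
      ‖t - s‖ₑ * eLpNorm (fun z : E × E => z.1 - z.2) 2 γ := by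
  refine (MW₂_map_le hγ (interpCLM E s) (interpCLM E t)).trans_eq ?_
  rw [← eLpNorm_const_smul]
  exact congrArg (eLpNorm · 2 γ) (funext (interp_sub_interp s t))

variable [BorelSpace E] [FiniteDimensional ℝ E]

theorem exists_path_of_isOptimalPlan {μ₀ μ₁ : GMM E} {γ : Measure (E × E)}
    (hγ : IsOptimalPlan μ₀.1 μ₁.1 γ) :
    letI := gmmMetricSpace E
    ∃ ρ : Path μ₀ μ₁, (∀ t : I, (ρ t).1 = γ.map (interp (t : ℝ))) ∧
      IsConstantSpeedGeodesic ρ := by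
  let := gmmMetricSpace E
  let f : I → GMM E := fun t => ⟨γ.map (interp (t : ℝ)), map_mem_GMM hγ.1.2 (interpCLM E t)⟩
  have hedist (s t : I) : edist (f s) (f t) ≤ edist s t * edist μ₀ μ₁ := by
    have h := MW₂_map_interp_le hγ.1.2 s t
    rwa [← hγ.MW₂_eq, ← edist_eq_enorm_sub, edist_comm] at h
  have hlip : LipschitzWith (nndist μ₀ μ₁) f := fun s t =>
    (hedist s t).trans_eq (by rw [edist_nndist μ₀, mul_comm])
  have hsource : f 0 = μ₀ := Subtype.ext ((map_interp_zero γ).trans hγ.1.1.1)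
  have htarget : f 1 = μ₁ := Subtype.ext ((map_interp_one γ).trans hγ.1.1.2)
  refine ⟨⟨⟨f, hlip.continuous⟩, hsource, htarget⟩, fun t => rfl,
    isConstantSpeedGeodesic_of_dist_le fun s t => (hlip.dist_le_mul s t).trans_eq ?_⟩
  rw [coe_nndist, mul_comm, dist_comm s, Subtype.dist_eq, Real.dist_eq]

end Geodesics

theorem mainTheorem2_general (E : Type*) [NormedAddCommGroup E] [NormedSpace ℝ E]
    [MeasurableSpace E] [BorelSpace E] [FiniteDimensional ℝ E] :
    ∃ _ : MetricSpace (GMM E),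
      (∀ μ ν : GMM E, edist μ ν = MW₂ μ.1 ν.1) ∧
      IsGeodesicSpace (GMM E) ∧
      ∀ μ₀ μ₁ : GMM E,
        (∃ γ, IsOptimalPlan μ₀.1 μ₁.1 γ) ∧
        ∀ γ, IsOptimalPlan μ₀.1 μ₁.1 γ →
          ∃ ρ : Path μ₀ μ₁,
            (∀ t : unitInterval, (ρ t).1 = γ.map (interp (t : ℝ))) ∧
            IsConstantSpeedGeodesic ρ ∧
            pathLength ρ = edist μ₀ μ₁ := by
  let := gmmMetricSpace E
  refine ⟨inferInstance, fun μ ν => rfl, fun μ₀ μ₁ => ?_, fun μ₀ μ₁ =>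
    ⟨exists_isOptimalPlan μ₀.2 μ₁.2, fun γ hγ => ?_⟩⟩
  · obtain ⟨γ, hγ⟩ := exists_isOptimalPlan μ₀.2 μ₁.2
    obtain ⟨ρ, -, hspeed⟩ := exists_path_of_isOptimalPlan hγ
    exact ⟨ρ, hspeed.pathLength_eq⟩
  · obtain ⟨ρ, hρ, hspeed⟩ := exists_path_of_isOptimalPlan hγ
    exact ⟨ρ, hρ, hspeed, hspeed.pathLength_eq⟩

theorem mainTheorem2 (d : ℕ) :
    ∃ _ : MetricSpace (GMM (EuclideanSpace ℝ (Fin d))),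
      (∀ μ ν : GMM (EuclideanSpace ℝ (Fin d)), edist μ ν = MW₂ μ.1 ν.1) ∧
      IsGeodesicSpace (GMM (EuclideanSpace ℝ (Fin d))) ∧
      ∀ μ₀ μ₁ : GMM (EuclideanSpace ℝ (Fin d)),
        (∃ γ, IsOptimalPlan μ₀.1 μ₁.1 γ) ∧
        ∀ γ, IsOptimalPlan μ₀.1 μ₁.1 γ →
          ∃ ρ : Path μ₀ μ₁,
            (∀ t : unitInterval, (ρ t).1 = γ.map (interp (t : ℝ))) ∧
            IsConstantSpeedGeodesic ρ ∧
            pathLength ρ = edist μ₀ μ₁ :=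
  mainTheorem2_general _
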